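/- Fix $K\in\mathbb N$ and $\beta\in\mathbb R^K$. Consider a sequence, indexed by $N$, of data generating processes with $T=T_N\to\infty$ as $N\to\infty$, and panel models with $N\times T$ matrices $$Y=\sum_{k=1}^K\beta_kX_k+\Gamma+E,\qquad X_k=\Pi_k+E_k\quad (k=1,\dots,K),$$ where $\Gamma_{it}=\sum_{j=1}^{r_N}\lambda_{ij}f_{tj}\delta_j$ and $(\Pi_k)_{it}=\sum_{j=1}^{r_N}\lambda_{ij}f_{tj}\delta_{kj}$, with random loadings $\lambda_i$ and factors $f_t$ in $\mathbb R^{r_N}$, nonrandom $\delta,\delta_1,\dots,\delta_K\in\mathbb R^{r_N}$, and random $N\times T$ error matrices $E,E_1,\dots,E_K$ (all these objects may depend on $N$). Let $\Pi_0=\sum_{k=1}^K\beta_k\Pi_k+\Gamma$, $\Pi_u=(\Pi_0,\dots,\Pi_K)$ and $\Pi_v=(\Pi_0^\top,\dots,\Pi_K^\top)$. For $z\in\{u,v\}$, let $r_z$ be the rank of $\Pi_z$ and $M_z$ the orthogonal projector on the orthogonal complement of the span of the columns of $\Pi_z$; for an $N\times T$ matrix $A$ put $\widetilde A=M_uAM_v$.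 Write $\langle A,B\rangle=\mathrm{tr}(A^\top B)$ and $|A|_2=\langle A,A\rangle^{1/2}$. Assume that there are $\sigma,\sigma_1,\dots,\sigma_K>0$, not depending on $N$, such that for every $N$: $E,E_1,\dots,E_K$ are mutually independent, the entries of $E$ are i.i.d. $\mathcal N(0,\sigma^2)$, for each $k$ the entries of $E_k$ are i.i.d. $\mathcal N(0,\sigma_k^2)$, and $(E,E_1,\dots,E_K)$ is independent of $(\Pi_u,\Pi_v)$. Assume also that $r_u+r_v=o_P(\sqrt{N\wedge T})$ as $N\to\infty$. Then, as $N\to\infty$: (i) there is a (deterministic) $K\times K$ positive definite matrix $\Sigma$ such that $\langle\widetilde E_k,\widetilde E_l\rangle/(NT)\xrightarrow{\mathbb P}\Sigma_{kl}$ for all $k,l\in\{1,\dots,K\}$; (ii) with the same $\Sigma$, there is $s>0$ such that $|\widetilde E|_2^2/(NT)\xrightarrow{\mathbb P}s^2$ and $\big(\langle\widetilde E_k,\widetilde E\rangle\big)_{k=1}^K/\sqrt{NT}\xrightarrow{d}\mathcal N(0,s^2\Sigma)$. -/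

import Mathlib

open MeasureTheory ProbabilityTheory Filter Topology

noncomputable section

namespace PanelFactor

/-- The product measurable structure (generated by the entries) on real matrices. -/
instance matrixMeasurableSpace (m n : Type*) : MeasurableSpace (Matrix m n ℝ) :=
  inferInstanceAs (MeasurableSpace (m → n → ℝ))

/-- The scalar product `tr(AᵀB)` on `m × n` real matrices. -/
def frobInner {m n : Type*} [Fintype m] [Fintype n] (A B : Matrix m n ℝ) : ℝ :=
  (A.transpose * B).trace

/-- The norm on `m × n` real matrices associated with `frobInner` (the Euclidean norm of the
entries). -/
def frobNorm {m n : Type*} [Fintype m] [Fintype n] (A : Matrix m n ℝ) : ℝ :=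
  Real.sqrt (frobInner A A)

/-- The span of the columns of `A`, in Euclidean space. -/
def colSpan {m n : Type*} (A : Matrix m n ℝ) : Submodule ℝ (EuclideanSpace ℝ m) :=
  Submodule.span ℝ (Set.range fun j : n => WithLp.toLp 2 fun i : m => A i j)

/-- The matrix of the orthogonal projector on the orthogonal complement of the span of the
columns of `A`. -/
def orthProj {m n : Type*} [Fintype m] [DecidableEq m] (A : Matrix m n ℝ) : Matrix m m ℝ :=
  Matrix.toEuclideanLin.symm
    ((colSpan A)ᗮ.starProjection : EuclideanSpace ℝ m →ₗ[ℝ] EuclideanSpace ℝ m)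

/-- Convergence in probability to a deterministic limit, for random variables which may be defined
on a different probability space for each `N`. -/
def TendstoInProb {Ω : ℕ → Type*} [∀ N, MeasurableSpace (Ω N)] (μ : ∀ N, Measure (Ω N))
    (X : ∀ N, Ω N → ℝ) (c : ℝ) : Prop :=
  ∀ ε : ℝ, 0 < ε → Tendsto (fun N => μ N {ω | ε ≤ |X N ω - c|}) atTop (𝓝 0)

/-- `X_N = o_P(a_N)`: the ratio `X_N / a_N` tends to `0` in probability. -/
def IsLittleOP {Ω : ℕ → Type*} [∀ N, MeasurableSpace (Ω N)] (μ : ∀ N, Measure (Ω N))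
    (X : ∀ N, Ω N → ℝ) (a : ℕ → ℝ) : Prop :=
  TendstoInProb μ (fun N ω => X N ω / a N) 0

/-- A sequence, indexed by the sample size `N`, of panels with interactive effects
`Y_{it} = ∑_k β_k X_{kit} + ∑_j λ_{ij} f_{tj} δ_j + E_{it}` and
`X_{kit} = ∑_j λ_{ij} f_{tj} δ_{kj} + E_{kit}`, with `K` regressors.
The dimensions are `N × T N`, the number of factors is `r N`. -/
structure PanelModel (K : ℕ) (Ω : ℕ → Type*) [∀ N, MeasurableSpace (Ω N)] where
  /-- The number of time periods. -/
  T : ℕ → ℕ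
  tendsto_T : Tendsto T atTop atTop
  /-- The number of factors. -/
  r : ℕ → ℕ
  /-- The regression coefficients. -/
  β : Fin K → ℝ
  /-- The random factor loadings `λ_{ij}`. -/
  loading : ∀ N, Ω N → Matrix (Fin N) (Fin (r N)) ℝ
  /-- The random factors `f_{tj}`. -/
  factor : ∀ N, Ω N → Matrix (Fin (T N)) (Fin (r N)) ℝ
  /-- The nonrandom vector `δ` of the outcome equation. -/
  δ : ∀ N, Fin (r N) → ℝ
  /-- The nonrandom vectors `δ_k` of the regressor equations. -/
  δX : ∀ N, Fin K → Fin (r N) → ℝ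
  /-- The random error matrix `E` of the outcome equation. -/
  E : ∀ N, Ω N → Matrix (Fin N) (Fin (T N)) ℝ
  /-- The random error matrices `E_k` of the regressor equations. -/
  EX : ∀ N, Fin K → Ω N → Matrix (Fin N) (Fin (T N)) ℝ
  measurable_loading : ∀ N i j, Measurable fun ω => loading N ω i j
  measurable_factor : ∀ N t j, Measurable fun ω => factor N ω t j
  measurable_E : ∀ N i t, Measurable fun ω => E N ω i t
  measurable_EX : ∀ N k i t, Measurable fun ω => EX N k ω i t

namespace PanelModel

variable {K : ℕ} {Ω : ℕ → Type*} [∀ N, MeasurableSpace (Ω N)] (S : PanelModel K Ω)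

/-- `Γ_{it} = ∑_j λ_{ij} f_{tj} δ_j`. -/
def Gam (N : ℕ) (ω : Ω N) : Matrix (Fin N) (Fin (S.T N)) ℝ :=
  Matrix.of fun i t => ∑ j, S.loading N ω i j * S.factor N ω t j * S.δ N j

/-- `(Π_k)_{it} = ∑_j λ_{ij} f_{tj} δ_{kj}` for `k = 1, …, K`. -/
def PiX (N : ℕ) (k : Fin K) (ω : Ω N) : Matrix (Fin N) (Fin (S.T N)) ℝ :=
  Matrix.of fun i t => ∑ j, S.loading N ω i j * S.factor N ω t j * S.δX N k j

/-- `Π_0 = ∑_k β_k Π_k + Γ`. -/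
def Pi0 (N : ℕ) (ω : Ω N) : Matrix (Fin N) (Fin (S.T N)) ℝ :=
  (∑ k, S.β k • S.PiX N k ω) + S.Gam N ω

/-- The family `Π_0, Π_1, …, Π_K`. -/
def PiAll (N : ℕ) (ω : Ω N) : Fin (K + 1) → Matrix (Fin N) (Fin (S.T N)) ℝ :=
  Fin.cons (S.Pi0 N ω) fun k => S.PiX N k ω

/-- The block matrix `Π_u = (Π_0, …, Π_K)`, of size `N × (K+1)T`. -/
def PiU (N : ℕ) (ω : Ω N) : Matrix (Fin N) (Fin (K + 1) × Fin (S.T N)) ℝ :=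
  Matrix.of fun i p => S.PiAll N ω p.1 i p.2

/-- The block matrix `Π_v = (Π_0ᵀ, …, Π_Kᵀ)`, of size `T × (K+1)N`. -/
def PiV (N : ℕ) (ω : Ω N) : Matrix (Fin (S.T N)) (Fin (K + 1) × Fin N) ℝ :=
  Matrix.of fun t p => S.PiAll N ω p.1 p.2 t

/-- `M_u`, the projector on the orthogonal of the span of the columns of `Π_u`. -/
def Mu (N : ℕ) (ω : Ω N) : Matrix (Fin N) (Fin N) ℝ := orthProj (S.PiU N ω)

/-- `M_v`, the projector on the orthogonal of the span of the columns of `Π_v`. -/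
def Mv (N : ℕ) (ω : Ω N) : Matrix (Fin (S.T N)) (Fin (S.T N)) ℝ := orthProj (S.PiV N ω)

/-- `r_u`, the rank of `Π_u`. -/
def ru (N : ℕ) (ω : Ω N) : ℕ := (S.PiU N ω).rank

/-- `r_v`, the rank of `Π_v`. -/
def rv (N : ℕ) (ω : Ω N) : ℕ := (S.PiV N ω).rank

/-- `M_u E M_v`. -/
def tildeE (N : ℕ) (ω : Ω N) : Matrix (Fin N) (Fin (S.T N)) ℝ :=
  S.Mu N ω * S.E N ω * S.Mv N ω

/-- `M_u E_k M_v`. -/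
def tildeEX (N : ℕ) (k : Fin K) (ω : Ω N) : Matrix (Fin N) (Fin (S.T N)) ℝ :=
  S.Mu N ω * S.EX N k ω * S.Mv N ω

/-- The family `E, E_1, …, E_K` of error matrices. -/
def errors (N : ℕ) (ω : Ω N) : Fin (K + 1) → Matrix (Fin N) (Fin (S.T N)) ℝ :=
  Fin.cons (S.E N ω) fun k => S.EX N k ω

/-- The asymptotic behaviour of the projected errors: there are a positive definite matrix `V` and
`σ > 0` such that `⟨M_u E_k M_v, M_u E_l M_v⟩ / (NT) → V_{kl}` and `|M_u E M_v|² / (NT) → σ²` in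
probability, and the vector `(⟨M_u E_k M_v, M_u E M_v⟩)_k / √(NT)` converges in distribution
to `𝒩(0, σ² V)`. -/
def ErrorAsymptotics (μ : ∀ N, Measure (Ω N)) [∀ N, IsProbabilityMeasure (μ N)] : Prop :=
  ∃ V : Matrix (Fin K) (Fin K) ℝ, V.PosDef ∧
    (∀ k l : Fin K, TendstoInProb μ
      (fun N ω => frobInner (S.tildeEX N k ω) (S.tildeEX N l ω) / ((N : ℝ) * (S.T N : ℝ)))
      (V k l)) ∧
    ∃ σ : ℝ, 0 < σ ∧
      TendstoInProb μ
        (fun N ω => frobNorm (S.tildeE N ω) ^ 2 / ((N : ℝ) * (S.T N : ℝ))) (σ ^ 2) ∧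
      TendstoInDistribution
        (fun N ω => (WithLp.toLp 2 fun k : Fin K =>
          frobInner (S.tildeEX N k ω) (S.tildeE N ω) / Real.sqrt ((N : ℝ) * (S.T N : ℝ)) :
            EuclideanSpace ℝ (Fin K)))
        atTop (id : EuclideanSpace ℝ (Fin K) → EuclideanSpace ℝ (Fin K)) μ
        (multivariateGaussian 0 (σ ^ 2 • V))

end PanelModel

/-- The entries of the random matrix `A` are i.i.d. with law `𝒩(0, s²)`. -/
def IIDGaussianEntries {Ω : Type*} [MeasurableSpace Ω] (μ : Measure Ω) {m n : Type*}
    (A : Ω → Matrix m n ℝ) (s : ℝ) : Prop :=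
  iIndepFun (fun (p : m × n) ω => A ω p.1 p.2) μ ∧
    ∀ i t, HasLaw (fun ω => A ω i t) (gaussianReal 0 (Real.toNNReal (s ^ 2))) μ

end PanelFactor

end

/-! For fixed projectors, `A ↦ M_u A M_v` is an orthogonal projection for the trace product. So the
defect `⟨A, B⟩ - ⟨M_u A M_v, M_u B M_v⟩` is the product of the two residuals, and it is at most half
the sum of the defects of `(A, A)` and `(B, B)`.

If `A` has i.i.d. `𝒩(0, s²)` entries and is independent of the projectors, only diagonal terms
survive in the mean of `⟨M_u A M_v, A⟩`, which is `s² 𝔼[(N - r_u)(T - r_v)]`. Hence the mean defect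
over `NT` is `s² 𝔼[W]`, where `W` lies in `[0, 1]` and `W ≤ r_u/N + r_v/T`. The rank assumption and
bounded convergence give `𝔼[W] → 0`, and Markov's inequality makes the defect negligible
(`tendstoInProb_defect`). The law of large numbers for unprojected matrices then gives part (i) with
`Σ = diag(σ_k²)`, and the first claim of part (ii) with `s = σ`.

No central limit theorem is needed for the score. Since `⟨M_u E_k M_v, M_u E M_v⟩ = ⟨M_u E_k M_v,
E⟩`, and `E` is Gaussian and independent of the `E_k` and the projectors, the score is conditionally
Gaussian. Its covariance is `σ²` times the Gram matrix of part (i). So its characteristic function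
at `t` is exactly `𝔼 exp(-σ² G_N(t)/2)`, with `G_N(t)` the Gram form (`charFun_score`). As `G_N(t)`
tends to `tᵀΣt` in probability and `exp(-x)` is bounded and Lipschitz on `x ≥ 0`, Lévy's continuity
theorem concludes. -/

namespace PanelFactor

/-! ### Trace product and orthogonal projectors -/

section LinearAlgebra

variable {m n : Type*} [Fintype m] [Fintype n]

lemma frobInner_eq_sum (A B : Matrix m n ℝ) :
    frobInner A B = ∑ p : m × n, A p.1 p.2 * B p.1 p.2 := by
  simp only [frobInner, Matrix.trace, Matrix.diag, Matrix.mul_apply, Matrix.transpose_apply]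
  rw [Finset.sum_comm, Fintype.sum_prod_type]

lemma frobInner_comm (A B : Matrix m n ℝ) : frobInner A B = frobInner B A := by
  simp only [frobInner_eq_sum, mul_comm]

lemma frobInner_self_nonneg (A : Matrix m n ℝ) : 0 ≤ frobInner A A := by
  rw [frobInner_eq_sum]
  exact Finset.sum_nonneg fun p _ => mul_self_nonneg _

lemma frobNorm_sq (A : Matrix m n ℝ) : frobNorm A ^ 2 = frobInner A A :=
  Real.sq_sqrt (frobInner_self_nonneg A)

/-- Positivity of the squares of `A + B` and `A - B`. This additive form, rather than
Cauchy–Schwarz, bounds a mixed defect by a sum of two defects. -/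
lemma two_mul_abs_frobInner_le (A B : Matrix m n ℝ) :
    2 * |frobInner A B| ≤ frobInner A A + frobInner B B := by
  have h1 := frobInner_self_nonneg (A + B)
  have h2 := frobInner_self_nonneg (A - B)
  have e1 : frobInner (A + B) (A + B) = frobInner A A + 2 * frobInner A B + frobInner B B := by
    simp only [frobInner_eq_sum, Finset.mul_sum, ← Finset.sum_add_distrib, Matrix.add_apply]
    exact Finset.sum_congr rfl fun p _ => by ring
  have e2 : frobInner (A - B) (A - B) = frobInner A A - 2 * frobInner A B + frobInner B B := by
    simp only [frobInner_eq_sum, Finset.mul_sum, ← Finset.sum_add_distrib,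
      ← Finset.sum_sub_distrib, Matrix.sub_apply]
    exact Finset.sum_congr rfl fun p _ => by ring
  rcases abs_cases (frobInner A B) with h | h <;> linarith

/-- Two-sided multiplication by symmetric idempotents is a symmetric idempotent operation. -/
lemma frobInner_conj_conj {P : Matrix m m ℝ} {Q : Matrix n n ℝ} (hP : P.transpose = P)
    (hP2 : P * P = P) (hQ : Q.transpose = Q) (hQ2 : Q * Q = Q) (A B : Matrix m n ℝ) :
    frobInner (P * A * Q) (P * B * Q) = frobInner (P * A * Q) B := by
  simp only [frobInner, Matrix.transpose_mul, hP, hQ]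
  -- Cyclicity of the trace brings the last `Q` next to the first one, so that `Q * Q = Q` applies.
  rw [← Matrix.mul_assoc, Matrix.trace_mul_comm]
  simp only [← Matrix.mul_assoc, hQ2]
  simp only [Matrix.mul_assoc]
  rw [← Matrix.mul_assoc P P, hP2]

/-- Pythagoras: both cross terms equal the product of the projections. -/
lemma frobInner_sub_conj {P : Matrix m m ℝ} {Q : Matrix n n ℝ} (hP : P.transpose = P)
    (hP2 : P * P = P) (hQ : Q.transpose = Q) (hQ2 : Q * Q = Q) (A B : Matrix m n ℝ) :
    frobInner (A - P * A * Q) (B - P * B * Q)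
      = frobInner A B - frobInner (P * A * Q) (P * B * Q) := by
  have h1 := frobInner_conj_conj hP hP2 hQ hQ2 A B
  have h2 := frobInner_conj_conj hP hP2 hQ hQ2 B A
  rw [frobInner_comm, frobInner_comm _ A] at h2
  have e : frobInner (A - P * A * Q) (B - P * B * Q) = frobInner A B - frobInner (P * A * Q) B
      - frobInner A (P * B * Q) + frobInner (P * A * Q) (P * B * Q) := by
    simp only [frobInner_eq_sum, ← Finset.sum_add_distrib,
      ← Finset.sum_sub_distrib, Matrix.sub_apply]
    exact Finset.sum_congr rfl fun p _ => by ring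
  rw [e]
  linarith

/-- The expansion of `⟨P A Q, A⟩` in the products of pairs of entries of `A`. -/
lemma frobInner_conj_eq_sum (P : Matrix m m ℝ) (Q : Matrix n n ℝ) (A : Matrix m n ℝ) :
    frobInner (P * A * Q) A = ∑ p : m × n, ∑ q : m × n,
      (P p.1 q.1 * Q q.2 p.2) * (A q.1 q.2 * A p.1 p.2) := by
  rw [frobInner_eq_sum]
  refine Finset.sum_congr rfl fun p _ => ?_
  simp only [Matrix.mul_apply, Finset.sum_mul, Fintype.sum_prod_type]
  rw [Finset.sum_comm]
  exact Finset.sum_congr rfl fun i _ => Finset.sum_congr rfl fun j _ => by ring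

omit [Fintype n] in
lemma toEuclideanLin_orthProj [DecidableEq m] (A : Matrix m n ℝ) :
    Matrix.toEuclideanLin (orthProj A)
      = ((colSpan A)ᗮ.starProjection : EuclideanSpace ℝ m →ₗ[ℝ] EuclideanSpace ℝ m) :=
  LinearEquiv.apply_symm_apply _ _

omit [Fintype n] in
lemma orthProj_apply [DecidableEq m] (A : Matrix m n ℝ) (i j : m) :
    orthProj A i j = inner ℝ (EuclideanSpace.single i (1 : ℝ))
      ((colSpan A)ᗮ.starProjection (EuclideanSpace.single j 1)) := by
  have h : (colSpan A)ᗮ.starProjection (EuclideanSpace.single j 1)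
      = Matrix.toEuclideanLin (orthProj A) (EuclideanSpace.single j 1) := by
    rw [toEuclideanLin_orthProj]; rfl
  rw [h, Matrix.toLpLin_apply]
  simp [EuclideanSpace.inner_single_left]

omit [Fintype n] in
lemma orthProj_transpose [DecidableEq m] (A : Matrix m n ℝ) : (orthProj A).transpose = orthProj A := by
  ext i j
  rw [Matrix.transpose_apply, orthProj_apply, orthProj_apply, real_inner_comm,
    Submodule.inner_starProjection_left_eq_right]

omit [Fintype n] in
lemma orthProj_mul_self [DecidableEq m] (A : Matrix m n ℝ) : orthProj A * orthProj A = orthProj A := by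
  apply Matrix.toEuclideanLin.injective
  rw [Matrix.toLpLin_mul_same, toEuclideanLin_orthProj]
  ext1 x
  exact congrArg (fun f : EuclideanSpace ℝ m →L[ℝ] EuclideanSpace ℝ m => f x)
    (Submodule.isIdempotentElem_starProjection (colSpan A)ᗮ).eq

omit [Fintype n] in
-- Cauchy–Schwarz for unit vectors and a contraction. Bounded entries make products with the random
-- projectors integrable.
lemma abs_orthProj_le [DecidableEq m] (A : Matrix m n ℝ) (i j : m) : |orthProj A i j| ≤ 1 := by
  rw [orthProj_apply]
  refine (abs_real_inner_le_norm _ _).trans ?_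
  have := Submodule.norm_starProjection_apply_le (colSpan A)ᗮ
    (EuclideanSpace.single j (1 : ℝ))
  simpa using this

omit [Fintype m] in
lemma finrank_colSpan (A : Matrix m n ℝ) : Module.finrank ℝ (colSpan A) = A.rank := by
  rw [Matrix.rank_eq_finrank_span_cols]
  have : colSpan A = (Submodule.span ℝ (Set.range A.col)).map
      (WithLp.linearEquiv 2 ℝ (m → ℝ)).symm.toLinearMap := by
    rw [Submodule.map_span, ← Set.range_comp]; rfl
  rw [this]
  exact LinearEquiv.finrank_map_eq _ _

lemma trace_orthProj [DecidableEq m] (A : Matrix m n ℝ) :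
    (orthProj A).trace = (Fintype.card m : ℝ) - A.rank := by
  have hproj : LinearMap.IsProj (colSpan A)ᗮ
      ((colSpan A)ᗮ.starProjection : EuclideanSpace ℝ m →ₗ[ℝ] EuclideanSpace ℝ m) :=
    ⟨fun x => Submodule.starProjection_apply_mem _ _,
      fun x hx => Submodule.starProjection_eq_self_iff.2 hx⟩
  have h1 := hproj.trace
  rw [← toEuclideanLin_orthProj, Matrix.toEuclideanLin, Matrix.toLpLin_eq_toLin, Matrix.trace_toLin_eq] at h1
  have h2 := Submodule.finrank_add_finrank_orthogonal (colSpan A)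
  rw [finrank_colSpan, finrank_euclideanSpace] at h2
  rw [h1, ← h2]
  push_cast
  ring

omit [Fintype m] in
lemma mem_colSpan_iff (A : Matrix m n ℝ) (y : EuclideanSpace ℝ m) :
    y ∈ colSpan A ↔ ∃ c : n → ℝ, WithLp.toLp 2 (A.mulVec c) = y := by
  rw [colSpan, Submodule.mem_span_range_iff_exists_fun]
  refine exists_congr fun c => ?_
  have : (∑ j, c j • (WithLp.toLp 2 fun i => A i j : EuclideanSpace ℝ m))
      = WithLp.toLp 2 (A.mulVec c) := by
    ext i
    simp [Matrix.mulVec, dotProduct, mul_comm]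
  rw [this]

/-- The norm of the residual is the distance to the column span, an infimum over coefficient
vectors. By continuity a countable dense set suffices, which makes this norm measurable in `A`. -/
lemma norm_starProjection_lt_iff (A : Matrix m n ℝ) (x : EuclideanSpace ℝ m) (a : ℝ) :
    ‖(colSpan A)ᗮ.starProjection x‖ < a ↔
      ∃ k : ℕ, ‖x - WithLp.toLp 2 (A.mulVec (TopologicalSpace.denseSeq (n → ℝ) k))‖ < a := by
  have hx : (colSpan A)ᗮ.starProjection x = x - (colSpan A).starProjection x := by
    rw [Submodule.starProjection_orthogonal]; rfl
  rw [hx]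
  constructor
  · intro h
    obtain ⟨c, hc⟩ := (mem_colSpan_iff A _).1 (Submodule.starProjection_apply_mem (colSpan A) x)
    rw [← hc] at h
    have hopen : IsOpen {c : n → ℝ | ‖x - WithLp.toLp 2 (A.mulVec c)‖ < a} := by
      refine isOpen_lt ?_ continuous_const
      have : Continuous fun c : n → ℝ => A.mulVec c := by fun_prop
      fun_prop
    obtain ⟨_, hy, k, rfl⟩ :=
      (TopologicalSpace.denseRange_denseSeq (n → ℝ)).inter_open_nonempty _ hopen ⟨c, h⟩
    exact ⟨k, hy⟩
  · rintro ⟨k, hk⟩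
    refine lt_of_le_of_lt ?_ hk
    rw [Submodule.starProjection_minimal]
    exact ciInf_le (f := fun y : colSpan A => ‖x - y‖) ⟨0, by rintro _ ⟨y, rfl⟩; positivity⟩
      ⟨_, (mem_colSpan_iff A _).2 ⟨_, rfl⟩⟩

end LinearAlgebra

/-! ### Measurability of random projectors -/

section Measurability

variable {Ω : Type*} [MeasurableSpace Ω] {m n : Type*}

lemma measurable_matrix_iff {A : Ω → Matrix m n ℝ} :
    Measurable A ↔ ∀ i j, Measurable fun ω => A ω i j := by
  constructor
  · intro h i j
    exact (measurable_pi_apply j).comp ((measurable_pi_apply i).comp h)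
  · intro h
    exact measurable_pi_lambda _ fun i => measurable_pi_lambda _ fun j => h i j

lemma _root_.Measurable.matrix_entry {A : Ω → Matrix m n ℝ} (h : Measurable A) (i : m) (j : n) :
    Measurable fun ω => A ω i j :=
  measurable_matrix_iff.1 h i j

variable [Fintype m] [Fintype n]

omit [Fintype n] in
lemma _root_.Measurable.matrix_mul {l : Type*} {A : Ω → Matrix l m ℝ} {B : Ω → Matrix m n ℝ}
    (hA : Measurable A) (hB : Measurable B) : Measurable fun ω => A ω * B ω := by
  refine measurable_matrix_iff.2 fun i j => ?_
  simp only [Matrix.mul_apply]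
  exact Finset.measurable_sum _ fun k _ => (hA.matrix_entry i k).mul (hB.matrix_entry k j)

lemma _root_.Measurable.frobInner {A B : Ω → Matrix m n ℝ}
    (hA : Measurable A) (hB : Measurable B) : Measurable fun ω => frobInner (A ω) (B ω) := by
  simp only [frobInner_eq_sum]
  exact Finset.measurable_sum _ fun p _ => (hA.matrix_entry _ _).mul (hB.matrix_entry _ _)

lemma measurable_norm_starProjection [DecidableEq m] (x : EuclideanSpace ℝ m) :
    Measurable fun A : Matrix m n ℝ => ‖(colSpan A)ᗮ.starProjection x‖ := by
  refine measurable_of_Iio fun a => ?_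
  have : (fun A : Matrix m n ℝ => ‖(colSpan A)ᗮ.starProjection x‖) ⁻¹' Set.Iio a
      = ⋃ k : ℕ, {A | ‖x - WithLp.toLp 2
        (A.mulVec (TopologicalSpace.denseSeq (n → ℝ) k))‖ < a} := by
    ext A
    rw [Set.mem_iUnion]
    exact norm_starProjection_lt_iff A x a
  rw [this]
  refine MeasurableSet.iUnion fun k => measurableSet_lt ?_ measurable_const
  refine Measurable.norm (measurable_const.sub ?_)
  refine (WithLp.measurable_toLp 2 (m → ℝ)).comp (measurable_pi_lambda _ fun i => ?_)
  simp only [Matrix.mulVec, dotProduct]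
  exact Finset.measurable_sum _ fun j _ => (measurable_id.matrix_entry i j).mul_const _

/-- By polarization, the entries of a projector are combinations of squared norms of projected
vectors. -/
lemma measurable_orthProj [DecidableEq m] :
    Measurable fun A : Matrix m n ℝ => orthProj A := by
  refine measurable_matrix_iff.2 fun i j => ?_
  have h (A : Matrix m n ℝ) : orthProj A i j =
      (‖(colSpan A)ᗮ.starProjection (EuclideanSpace.single i (1 : ℝ) + EuclideanSpace.single j 1)‖
        * ‖(colSpan A)ᗮ.starProjection
            (EuclideanSpace.single i (1 : ℝ) + EuclideanSpace.single j 1)‖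
      - ‖(colSpan A)ᗮ.starProjection (EuclideanSpace.single i (1 : ℝ))‖
        * ‖(colSpan A)ᗮ.starProjection (EuclideanSpace.single i (1 : ℝ))‖
      - ‖(colSpan A)ᗮ.starProjection (EuclideanSpace.single j (1 : ℝ))‖
        * ‖(colSpan A)ᗮ.starProjection (EuclideanSpace.single j (1 : ℝ))‖) / 2 := by
    rw [map_add, ← real_inner_eq_norm_add_mul_self_sub_norm_mul_self_sub_norm_mul_self_div_two,
      Submodule.inner_starProjection_left_eq_right, orthProj_apply]
    congr 1
    exact (Submodule.starProjection_eq_self_iff.2 (Submodule.starProjection_apply_mem _ _)).symm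
  simp only [h]
  have := measurable_norm_starProjection (m := m) (n := n)
  fun_prop

end Measurability

/-! ### Convergence in probability -/

section Convergence

variable {Ω : ℕ → Type*} [∀ N, MeasurableSpace (Ω N)] {μ : ∀ N, Measure (Ω N)}

lemma TendstoInProb.mono {X Y Z : ∀ N, Ω N → ℝ} {c : ℝ} (hY : TendstoInProb μ Y c)
    (hZ : TendstoInProb μ Z 0) (h : ∀ N ω, |X N ω - Y N ω| ≤ Z N ω) : TendstoInProb μ X c := by
  intro ε hε
  have h0 := (hY (ε / 2) (by positivity)).add (hZ (ε / 2) (by positivity))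
  rw [add_zero] at h0
  refine tendsto_of_tendsto_of_tendsto_of_le_of_le tendsto_const_nhds h0 (fun N => zero_le)
    fun N => (measure_mono ?_).trans (measure_union_le _ _)
  intro ω hω
  simp only [Set.mem_ofPred_eq, Set.mem_union, sub_zero] at hω ⊢
  by_contra! hc
  have h1 := h N ω
  have h2 := le_abs_self (Z N ω)
  have h3 := abs_sub_le (X N ω) (Y N ω) c
  linarith [hc.1, hc.2]

lemma TendstoInProb.add {X Y : ∀ N, Ω N → ℝ} {a b : ℝ} (hX : TendstoInProb μ X a)
    (hY : TendstoInProb μ Y b) : TendstoInProb μ (fun N ω => X N ω + Y N ω) (a + b) := by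
  intro ε hε
  have h0 := (hX (ε / 2) (by positivity)).add (hY (ε / 2) (by positivity))
  rw [add_zero] at h0
  refine tendsto_of_tendsto_of_tendsto_of_le_of_le tendsto_const_nhds h0 (fun N => zero_le)
    fun N => (measure_mono ?_).trans (measure_union_le _ _)
  intro ω hω
  simp only [Set.mem_ofPred_eq, Set.mem_union] at hω ⊢
  by_contra! hc
  have h3 := abs_add_le (X N ω - a) (Y N ω - b)
  rw [show X N ω - a + (Y N ω - b) = X N ω + Y N ω - (a + b) by ring] at h3
  linarith [hc.1, hc.2]

lemma TendstoInProb.const_mul {X : ∀ N, Ω N → ℝ} {a : ℝ} (hX : TendstoInProb μ X a) (c : ℝ) :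
    TendstoInProb μ (fun N ω => c * X N ω) (c * a) := by
  intro ε hε
  refine tendsto_of_tendsto_of_tendsto_of_le_of_le tendsto_const_nhds
    (hX (ε / (|c| + 1)) (by positivity)) (fun N => zero_le) fun N => measure_mono ?_
  intro ω hω
  simp only [Set.mem_ofPred_eq] at hω ⊢
  rw [← mul_sub, abs_mul] at hω
  rw [div_le_iff₀ (by positivity)]
  nlinarith [abs_nonneg (X N ω - a), abs_nonneg c]

lemma TendstoInProb.sum {ι : Type*} (s : Finset ι) {X : ι → ∀ N, Ω N → ℝ} {a : ι → ℝ}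
    (hX : ∀ i ∈ s, TendstoInProb μ (X i) (a i)) :
    TendstoInProb μ (fun N ω => ∑ i ∈ s, X i N ω) (∑ i ∈ s, a i) := by
  classical
  induction s using Finset.induction_on with
  | empty =>
    intro ε hε
    simp [hε.not_ge]
  | insert i s hi ih =>
    simp only [Finset.sum_insert hi]
    exact (hX i (Finset.mem_insert_self i s)).add
      (ih fun j hj => hX j (Finset.mem_insert_of_mem hj))

variable [∀ N, IsProbabilityMeasure (μ N)]

/-- Markov's inequality. -/
lemma tendstoInProb_zero_of_integral {Z : ∀ N, Ω N → ℝ} (h0 : ∀ N ω, 0 ≤ Z N ω)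
    (hint : ∀ N, Integrable (Z N) (μ N)) (h : Tendsto (fun N => ∫ ω, Z N ω ∂μ N) atTop (𝓝 0)) :
    TendstoInProb μ Z 0 := by
  intro ε hε
  have h1 : Tendsto (fun N => ENNReal.ofReal ((∫ ω, Z N ω ∂μ N) / ε)) atTop (𝓝 0) := by
    have := ENNReal.tendsto_ofReal (h.div_const ε)
    simpa using this
  refine tendsto_of_tendsto_of_tendsto_of_le_of_le tendsto_const_nhds h1 (fun N => zero_le)
    fun N => ?_
  have h2 := mul_meas_ge_le_integral_of_nonneg (ae_of_all _ (h0 N)) (hint N) ε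
  simp only [sub_zero, abs_of_nonneg (h0 N _)]
  rw [← ofReal_measureReal]
  refine ENNReal.ofReal_le_ofReal ?_
  rw [le_div_iff₀ hε]
  linarith

lemma tendstoInProb_of_integral_sq {X : ∀ N, Ω N → ℝ} {c : ℝ}
    (hint : ∀ N, Integrable (fun ω => (X N ω - c) ^ 2) (μ N))
    (h : Tendsto (fun N => ∫ ω, (X N ω - c) ^ 2 ∂μ N) atTop (𝓝 0)) : TendstoInProb μ X c := by
  intro ε hε
  refine tendsto_of_tendsto_of_tendsto_of_le_of_le tendsto_const_nhds
    (tendstoInProb_zero_of_integral (fun N ω => sq_nonneg _) hint h (ε ^ 2) (by positivity))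
    (fun N => zero_le) fun N => measure_mono ?_
  intro ω hω
  simp only [Set.mem_ofPred_eq, sub_zero] at hω ⊢
  rw [abs_of_nonneg (sq_nonneg _), ← sq_abs (X N ω - c)]
  gcongr

/-- Bounded convergence: a sequence with values in `[0, 1]` which tends to `0` in probability
tends to `0` in mean. -/
lemma TendstoInProb.tendsto_integral {Z : ∀ N, Ω N → ℝ} (hZ : TendstoInProb μ Z 0)
    (hm : ∀ N, Measurable (Z N)) (h0 : ∀ N ω, 0 ≤ Z N ω) (h1 : ∀ N ω, Z N ω ≤ 1) :
    Tendsto (fun N => ∫ ω, Z N ω ∂μ N) atTop (𝓝 0) := by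
  have hint (N) : Integrable (Z N) (μ N) :=
    Integrable.of_bound (hm N).aestronglyMeasurable 1
      (ae_of_all _ fun ω => by rw [Real.norm_of_nonneg (h0 N ω)]; exact h1 N ω)
  rw [Metric.tendsto_atTop]
  intro ε hε
  have h2 := (ENNReal.tendsto_toReal ENNReal.zero_ne_top).comp (hZ (ε / 2) (by positivity))
  obtain ⟨N₀, hN₀⟩ := Metric.tendsto_atTop.1 h2 (ε / 2) (by positivity)
  refine ⟨N₀, fun N hN => ?_⟩
  have h3 := hN₀ N hN
  set s : Set (Ω N) := {ω | ε / 2 ≤ |Z N ω - 0|} with hs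
  have hsm : MeasurableSet s := by
    have := hm N
    exact measurableSet_le measurable_const (by fun_prop)
  have h3' : (μ N).real s < ε / 2 := by
    rw [Real.dist_eq, ENNReal.toReal_zero, sub_zero] at h3
    exact (le_abs_self _).trans_lt h3
  rw [Real.dist_eq, sub_zero, abs_of_nonneg (integral_nonneg (h0 N))]
  -- Off `s` the variable is below `ε / 2`; on `s` it is at most `1`, and `s` has measure below `ε /
  -- 2`.
  have h4 : ∫ ω, Z N ω ∂μ N ≤ ∫ ω, (ε / 2 + s.indicator (fun _ => (1 : ℝ)) ω) ∂μ N := by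
    refine integral_mono (hint N) ((integrable_const _).add
      ((integrable_const (1 : ℝ)).indicator hsm)) fun ω => ?_
    by_cases hω : ω ∈ s
    · simp only [Set.indicator_of_mem hω]
      linarith [h1 N ω]
    · have : Z N ω < ε / 2 := by
        simpa [hs, abs_of_nonneg (h0 N ω)] using hω
      simp only [Set.indicator_of_notMem hω]
      linarith
  rw [integral_add (integrable_const _) ((integrable_const (1 : ℝ)).indicator hsm),
    integral_indicator_const _ hsm] at h4
  simp only [integral_const, probReal_univ, smul_eq_mul, one_mul, mul_one] at h4
  linarith

lemma TendstoInProb.tendsto_integral_exp_neg {X : ∀ N, Ω N → ℝ} {c : ℝ}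
    (hX : TendstoInProb μ X c) (hm : ∀ N, Measurable (X N)) (h0 : ∀ N ω, 0 ≤ X N ω)
    (hc : 0 ≤ c) :
    Tendsto (fun N => ∫ ω, Real.exp (-X N ω) ∂μ N) atTop (𝓝 (Real.exp (-c))) := by
  -- `x ↦ exp(-x)` is `1`-Lipschitz with values in `[0, 1]` on the half-line, so `Z` dominates the
  -- error and bounded convergence applies to it.
  set Z : ∀ N, Ω N → ℝ := fun N ω => min 1 |X N ω - c|
  have hZ0 : ∀ N ω, 0 ≤ Z N ω := fun N ω => le_min zero_le_one (abs_nonneg _)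
  have hZm (N) : Measurable (Z N) := by
    have := hm N
    fun_prop
  have hZ : TendstoInProb μ Z 0 := by
    intro ε hε
    refine tendsto_of_tendsto_of_tendsto_of_le_of_le tendsto_const_nhds (hX ε hε)
      (fun N => zero_le) fun N => measure_mono fun ω hω => ?_
    simp only [Set.mem_ofPred_eq, sub_zero, abs_of_nonneg (hZ0 N ω)] at hω ⊢
    exact hω.trans (min_le_right _ _)
  have hI := hZ.tendsto_integral hZm hZ0 fun N ω => min_le_left _ _
  have hexp {a b : ℝ} (ha : 0 ≤ a) (hab : a ≤ b) :
      |Real.exp (-a) - Real.exp (-b)| ≤ min 1 (b - a) := by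
    have h1 : Real.exp (-b) ≤ Real.exp (-a) := Real.exp_le_exp.2 (by linarith)
    have h2 : Real.exp (-a) ≤ 1 := Real.exp_le_one_iff.2 (by linarith)
    have h3 : Real.exp (-b) = Real.exp (-a) * Real.exp (-(b - a)) := by
      rw [← Real.exp_add]; ring_nf
    have h4 := Real.add_one_le_exp (-(b - a))
    rw [abs_of_nonneg (by linarith)]
    refine le_min (by linarith [Real.exp_pos (-b)]) ?_
    nlinarith [Real.exp_pos (-a)]
  have hb (N ω) : |Real.exp (-X N ω) - Real.exp (-c)| ≤ Z N ω := by
    rcases le_total (X N ω) c with h | h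
    · have := hexp (h0 N ω) h
      simp only [Z]
      rwa [abs_sub_comm (X N ω), abs_of_nonneg (sub_nonneg.2 h)]
    · have := hexp hc h
      simp only [Z]
      rwa [abs_sub_comm, abs_of_nonneg (sub_nonneg.2 h)]
  have hi (N) : Integrable (fun ω => Real.exp (-X N ω)) (μ N) := by
    have := hm N
    refine Integrable.of_bound (by fun_prop) 1 (ae_of_all _ fun ω => ?_)
    rw [Real.norm_of_nonneg (Real.exp_pos _).le]
    exact Real.exp_le_one_iff.2 (by linarith [h0 N ω])
  rw [tendsto_iff_norm_sub_tendsto_zero]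
  refine squeeze_zero (fun N => norm_nonneg _) (fun N => ?_) hI
  have h5 : ∫ ω, Real.exp (-X N ω) ∂μ N - Real.exp (-c)
      = ∫ ω, (Real.exp (-X N ω) - Real.exp (-c)) ∂μ N := by
    rw [integral_sub (hi N) (integrable_const _)]; simp
  rw [h5]
  refine norm_integral_le_of_norm_le ?_ (ae_of_all _ (hb N))
  exact Integrable.of_bound (hZm N).aestronglyMeasurable 1
      (ae_of_all _ fun ω => by rw [Real.norm_of_nonneg (hZ0 N ω)]; exact min_le_left _ _)

end Convergence

/-! ### Independence and conditioning -/

section Independence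

variable {Ω : Type*} [MeasurableSpace Ω] {μ : Measure Ω} [IsProbabilityMeasure μ]

/-- Associativity of product measures: the joint law of the three variables is a triple product. -/
lemma indepFun_prodMk_right {α β γ : Type*} [MeasurableSpace α] [MeasurableSpace β]
    [MeasurableSpace γ] {X : Ω → α} {Y : Ω → β} {Z : Ω → γ} (hX : Measurable X)
    (hY : Measurable Y) (hZ : Measurable Z) (h : IndepFun X Y μ)
    (h' : IndepFun (fun ω => (X ω, Y ω)) Z μ) : IndepFun X (fun ω => (Y ω, Z ω)) μ := by
  have hYZ : IndepFun Y Z μ := h'.comp measurable_snd measurable_id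
  have : IsProbabilityMeasure (μ.map X) := Measure.isProbabilityMeasure_map hX.aemeasurable
  have : IsProbabilityMeasure (μ.map Y) := Measure.isProbabilityMeasure_map hY.aemeasurable
  have : IsProbabilityMeasure (μ.map Z) := Measure.isProbabilityMeasure_map hZ.aemeasurable
  rw [indepFun_iff_map_prod_eq_prod_map_map (by fun_prop) (by fun_prop)] at h h' hYZ ⊢
  rw [hYZ, ← Measure.prodAssoc_prod, ← h, ← h', Measure.map_map (by fun_prop) (by fun_prop)]
  rfl

/-- Integration in two steps of a bounded function of two independent variables. -/
lemma integral_comp_of_indepFun {α β : Type*} [MeasurableSpace α] [MeasurableSpace β]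
    {X : Ω → α} {Y : Ω → β} (hX : Measurable X) (hY : Measurable Y) (h : IndepFun X Y μ)
    {F : α × β → ℂ} (hF : Measurable F) {C : ℝ} (hC : ∀ z, ‖F z‖ ≤ C) {g : α → ℂ}
    (hg : Measurable g) (hFg : ∀ a, ∫ ω, F (a, Y ω) ∂μ = g a) :
    ∫ ω, F (X ω, Y ω) ∂μ = ∫ ω, g (X ω) ∂μ := by
  have : IsProbabilityMeasure (μ.map X) := Measure.isProbabilityMeasure_map hX.aemeasurable
  have : IsProbabilityMeasure (μ.map Y) := Measure.isProbabilityMeasure_map hY.aemeasurable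
  have h' := (indepFun_iff_map_prod_eq_prod_map_map hX.aemeasurable hY.aemeasurable).1 h
  have h2 (a : α) : ∫ b, F (a, b) ∂(μ.map Y) = g a := by
    rw [← hFg a]
    exact integral_map hY.aemeasurable (hF.comp measurable_prodMk_left).aestronglyMeasurable
  have h1 := integral_map (hX.prodMk hY).aemeasurable (μ := μ) hF.aestronglyMeasurable
  rw [← h1, h', integral_prod _ (Integrable.of_bound hF.aestronglyMeasurable C (ae_of_all _ hC))]
  simp only [h2]
  exact integral_map hX.aemeasurable hg.aestronglyMeasurable

end Independence

/-! ### Moments and characteristic functions of Gaussian matrices -/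

section Gaussian

variable {Ω : Type*} [MeasurableSpace Ω] {μ : Measure Ω}
  {m n : Type*} {A : Ω → Matrix m n ℝ} {s : ℝ}

lemma IIDGaussianEntries.memLp (hA : IIDGaussianEntries μ A s) (i : m) (t : n)
    {p : ENNReal} (hp : p ≠ ⊤) : MemLp (fun ω => A ω i t) p μ := by
  have h := (hA.2 i t)
  have := memLp_id_gaussianReal' (μ := 0) (v := Real.toNNReal (s ^ 2)) p hp
  rw [← h.map_eq, memLp_map_measure_iff aestronglyMeasurable_id h.aemeasurable] at this
  exact this

lemma IIDGaussianEntries.integral_eq_zero (hA : IIDGaussianEntries μ A s) (i : m) (t : n) :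
    ∫ ω, A ω i t ∂μ = 0 := by
  rw [(hA.2 i t).integral_eq, integral_id_gaussianReal]

lemma IIDGaussianEntries.integrable_mul (hA : IIDGaussianEntries μ A s) (p q : m × n) :
    Integrable (fun ω => A ω p.1 p.2 * A ω q.1 q.2) μ :=
  (hA.memLp p.1 p.2 (p := 2) (by simp)).integrable_mul (hA.memLp q.1 q.2 (p := 2) (by simp))

lemma IIDGaussianEntries.integral_mul [DecidableEq m] [DecidableEq n]
    (hA : IIDGaussianEntries μ A s) (p q : m × n) :
    ∫ ω, A ω p.1 p.2 * A ω q.1 q.2 ∂μ = if p = q then s ^ 2 else 0 := by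
  split_ifs with h
  · subst h
    have h1 := variance_id_gaussianReal (μ := 0) (v := Real.toNNReal (s ^ 2))
    rw [variance_of_integral_eq_zero aemeasurable_id (by simp)] at h1
    rw [← (hA.2 p.1 p.2).map_eq, integral_map (hA.2 p.1 p.2).aemeasurable
      (by fun_prop)] at h1
    rw [Real.coe_toNNReal _ (sq_nonneg s)] at h1
    rw [← h1]
    simp [sq]
  · rw [IndepFun.integral_fun_mul_eq_mul_integral (hA.1.indepFun h)
      (hA.memLp _ _ (p := 2) (by simp)).aestronglyMeasurable
      (hA.memLp _ _ (p := 2) (by simp)).aestronglyMeasurable]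
    simp [hA.integral_eq_zero]

variable [IsProbabilityMeasure μ] [Fintype m] [Fintype n]

/-- The mean squared norm of a Gaussian matrix multiplied on both sides by independent matrices. -/
lemma IIDGaussianEntries.integral_conj (hA : IIDGaussianEntries μ A s)
    {P : Ω → Matrix m m ℝ} {Q : Ω → Matrix n n ℝ} (hP : Measurable P)
    (hQ : Measurable Q) (hP1 : ∀ ω i j, |P ω i j| ≤ 1) (hQ1 : ∀ ω i j, |Q ω i j| ≤ 1)
    (hind : IndepFun A (fun ω => (P ω, Q ω)) μ) :
    Integrable (fun ω => frobInner (P ω * A ω * Q ω) (A ω)) μ ∧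
      ∫ ω, frobInner (P ω * A ω * Q ω) (A ω) ∂μ
        = s ^ 2 * ∫ ω, (P ω).trace * (Q ω).trace ∂μ := by
  classical
  have hind' (p q : m × n) : IndepFun (fun ω => P ω p.1 q.1 * Q ω q.2 p.2)
      (fun ω => A ω q.1 q.2 * A ω p.1 p.2) μ := by
    have hf : Measurable fun B : Matrix m n ℝ => B q.1 q.2 * B p.1 p.2 :=
      (measurable_id.matrix_entry _ _).mul (measurable_id.matrix_entry _ _)
    have hg : Measurable fun R : Matrix m m ℝ × Matrix n n ℝ => R.1 p.1 q.1 * R.2 q.2 p.2 :=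
      (measurable_fst.matrix_entry _ _).mul (measurable_snd.matrix_entry _ _)
    exact (hind.comp hf hg).symm
  have hPQ (p q : m × n) : Integrable (fun ω => P ω p.1 q.1 * Q ω q.2 p.2) μ := by
    refine Integrable.of_bound
      ((hP.matrix_entry _ _).mul (hQ.matrix_entry _ _)).aestronglyMeasurable 1
      (ae_of_all _ fun ω => ?_)
    rw [norm_mul]
    exact mul_le_one₀ (hP1 _ _ _) (norm_nonneg _) (hQ1 _ _ _)
  have hi (p q : m × n) : Integrable
      (fun ω => (P ω p.1 q.1 * Q ω q.2 p.2) * (A ω q.1 q.2 * A ω p.1 p.2)) μ :=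
    (hind' p q).integrable_mul (hPQ p q) (hA.integrable_mul q p)
  simp only [frobInner_conj_eq_sum]
  refine ⟨integrable_finsetSum _ fun p _ => integrable_finsetSum _ fun q _ => hi p q, ?_⟩
  rw [integral_finsetSum _ fun p _ => integrable_finsetSum _ fun q _ => hi p q]
  have htr (ω) : (P ω).trace * (Q ω).trace = ∑ p : m × n, P ω p.1 p.1 * Q ω p.2 p.2 := by
    simp only [Matrix.trace, Matrix.diag, Fintype.sum_mul_sum, Fintype.sum_prod_type]
  simp only [htr]
  rw [integral_finsetSum _ fun p _ => hPQ p p, Finset.mul_sum]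
  refine Finset.sum_congr rfl fun p _ => ?_
  rw [integral_finsetSum _ fun q _ => hi p q]
  have (q : m × n) : ∫ ω, (P ω p.1 q.1 * Q ω q.2 p.2) * (A ω q.1 q.2 * A ω p.1 p.2) ∂μ
      = if q = p then s ^ 2 * ∫ ω, P ω p.1 q.1 * Q ω q.2 p.2 ∂μ else 0 := by
    rw [(hind' p q).integral_fun_mul_eq_mul_integral (hPQ p q).aestronglyMeasurable
      (hA.integrable_mul q p).aestronglyMeasurable, hA.integral_mul]
    split_ifs <;> ring
  simp [this]

omit [IsProbabilityMeasure μ] in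
lemma IIDGaussianEntries.integrable_frobInner (hA : IIDGaussianEntries μ A s) :
    Integrable (fun ω => frobInner (A ω) (A ω)) μ := by
  simp only [frobInner_eq_sum]
  exact integrable_finsetSum _ fun p _ => hA.integrable_mul p p

omit [IsProbabilityMeasure μ] in
lemma IIDGaussianEntries.integral_frobInner (hA : IIDGaussianEntries μ A s) :
    ∫ ω, frobInner (A ω) (A ω) ∂μ = s ^ 2 * (Fintype.card m * Fintype.card n) := by
  classical
  simp only [frobInner_eq_sum]
  rw [integral_finsetSum _ fun p _ => hA.integrable_mul p p]
  simp [hA.integral_mul]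
  ring

omit [IsProbabilityMeasure μ] in
/-- The variance of the squared norm of a Gaussian matrix. -/
lemma IIDGaussianEntries.variance_frobInner (hA : IIDGaussianEntries μ A s) :
    MemLp (fun ω => frobInner (A ω) (A ω)) 2 μ ∧
    Var[fun ω => frobInner (A ω) (A ω); μ] =
      (Fintype.card m * Fintype.card n) *
        Var[fun x : ℝ => x * x; gaussianReal 0 (Real.toNNReal (s ^ 2))] := by
  have hL (p : m × n) : MemLp (fun ω => A ω p.1 p.2 * A ω p.1 p.2) 2 μ :=
    -- Hölder with `1/4 + 1/4 = 1/2`: Gaussian entries have fourth moments.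
    MemLp.mul (p := 4) (q := 4) (r := 2) (hA.memLp _ _ (by simp)) (hA.memLp _ _ (by simp))
      (hpqr := ⟨by
        rw [← two_mul, show (4 : ENNReal) = 2 * 2 by norm_num,
          ENNReal.mul_inv (by simp) (by simp), ← mul_assoc,
          ENNReal.mul_inv_cancel (by simp) (by simp), one_mul]⟩)
  have he : (fun ω => frobInner (A ω) (A ω))
      = ∑ p : m × n, fun ω => A ω p.1 p.2 * A ω p.1 p.2 := by
    ext ω
    simp [frobInner_eq_sum]
  rw [he]
  refine ⟨memLp_finsetSum' _ fun p _ => hL p, ?_⟩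
  rw [IndepFun.variance_sum fun p _ => hL p]
  · have (p : m × n) : Var[fun ω => A ω p.1 p.2 * A ω p.1 p.2; μ]
        = Var[fun x : ℝ => x * x; gaussianReal 0 (Real.toNNReal (s ^ 2))] := by
      rw [← (hA.2 p.1 p.2).map_eq, variance_map (by fun_prop) (hA.2 p.1 p.2).aemeasurable]
      rfl
    simp [this]
  · intro p _ q _ hpq
    have hf : Measurable fun x : ℝ => x * x := by fun_prop
    exact (hA.1.indepFun hpq).comp hf hf

omit [IsProbabilityMeasure μ] in
/-- The second moment of the scalar product of two independent Gaussian matrices. -/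
lemma IIDGaussianEntries.integral_frobInner_sq {B : Ω → Matrix m n ℝ} {r : ℝ}
    (hA : IIDGaussianEntries μ A s) (hB : IIDGaussianEntries μ B r) (hind : IndepFun A B μ) :
    Integrable (fun ω => frobInner (A ω) (B ω) ^ 2) μ ∧
    ∫ ω, frobInner (A ω) (B ω) ^ 2 ∂μ
      = (Fintype.card m * Fintype.card n) * (s ^ 2 * r ^ 2) := by
  classical
  have he (ω) : frobInner (A ω) (B ω) ^ 2 = ∑ p : m × n, ∑ q : m × n,
      (A ω p.1 p.2 * A ω q.1 q.2) * (B ω p.1 p.2 * B ω q.1 q.2) := by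
    rw [sq, frobInner_eq_sum, Fintype.sum_mul_sum]
    exact Finset.sum_congr rfl fun p _ => Finset.sum_congr rfl fun q _ => by ring
  have hind' (p q : m × n) : IndepFun (fun ω => A ω p.1 p.2 * A ω q.1 q.2)
      (fun ω => B ω p.1 p.2 * B ω q.1 q.2) μ := by
    have hf : Measurable fun B : Matrix m n ℝ => B p.1 p.2 * B q.1 q.2 :=
      (measurable_id.matrix_entry _ _).mul (measurable_id.matrix_entry _ _)
    exact hind.comp hf hf
  have hi (p q : m × n) : Integrable
      (fun ω => (A ω p.1 p.2 * A ω q.1 q.2) * (B ω p.1 p.2 * B ω q.1 q.2)) μ :=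
    (hind' p q).integrable_mul (hA.integrable_mul p q) (hB.integrable_mul p q)
  simp only [he]
  refine ⟨integrable_finsetSum _ fun p _ => integrable_finsetSum _ fun q _ => hi p q, ?_⟩
  rw [integral_finsetSum _ fun p _ => integrable_finsetSum _ fun q _ => hi p q]
  have (p q : m × n) : ∫ ω, (A ω p.1 p.2 * A ω q.1 q.2) * (B ω p.1 p.2 * B ω q.1 q.2) ∂μ
      = if p = q then s ^ 2 * r ^ 2 else 0 := by
    rw [(hind' p q).integral_fun_mul_eq_mul_integral (hA.integrable_mul p q).aestronglyMeasurable
      (hB.integrable_mul p q).aestronglyMeasurable, hA.integral_mul, hB.integral_mul]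
    split_ifs <;> ring
  have h2 (p : m × n) : ∫ ω, ∑ q : m × n, (A ω p.1 p.2 * A ω q.1 q.2) * (B ω p.1 p.2 * B ω q.1 q.2) ∂μ
      = s ^ 2 * r ^ 2 := by
    rw [integral_finsetSum _ fun q _ => hi p q]
    simp [this]
  simp [h2]

/-- The characteristic function of a Gaussian matrix. -/
lemma IIDGaussianEntries.integral_exp_frobInner (hA : IIDGaussianEntries μ A s)
    (b : Matrix m n ℝ) :
    ∫ ω, Complex.exp (frobInner b (A ω) * Complex.I) ∂μ
      = (Real.exp (-(s ^ 2 * frobInner b b / 2)) : ℝ) := by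
  have hm (p : m × n) : AEMeasurable (fun ω => A ω p.1 p.2) μ := (hA.2 p.1 p.2).aemeasurable
  have h := (iIndepFun_iff_charFun_pi (P := μ) hm).1 hA.1
    (WithLp.toLp 2 fun p : m × n => b p.1 p.2)
  have hmap (p : m × n) : μ.map (fun ω => A ω p.1 p.2)
      = gaussianReal 0 (Real.toNNReal (s ^ 2)) := (hA.2 p.1 p.2).map_eq
  simp only [hmap, charFun_gaussianReal] at h
  rw [charFun_apply, integral_map (by fun_prop) (by fun_prop)] at h
  have hin (ω) : (inner ℝ (WithLp.toLp 2 fun p : m × n => A ω p.1 p.2)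
      (WithLp.toLp 2 fun p : m × n => b p.1 p.2) : ℝ) = frobInner b (A ω) := by
    simp [PiLp.inner_apply, frobInner_eq_sum]
  simp only [hin] at h
  rw [h, ← Complex.exp_sum, Complex.ofReal_exp, frobInner_eq_sum]
  congr 1
  rw [Real.coe_toNNReal _ (sq_nonneg s)]
  push_cast
  rw [Finset.mul_sum, Finset.sum_div, ← Finset.sum_neg_distrib]
  exact Finset.sum_congr rfl fun p _ => by ring

/-- The characteristic function of the scalar product of a Gaussian matrix with an independent
random matrix. -/
lemma IIDGaussianEntries.integral_exp_frobInner_indep (hA : IIDGaussianEntries μ A s)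
    (hAm : Measurable A) {B : Ω → Matrix m n ℝ} (hB : Measurable B) (hind : IndepFun B A μ) :
    ∫ ω, Complex.exp (frobInner (B ω) (A ω) * Complex.I) ∂μ
      = ((∫ ω, Real.exp (-(s ^ 2 * frobInner (B ω) (B ω) / 2)) ∂μ : ℝ) : ℂ) := by
  have hF : Measurable fun z : Matrix m n ℝ × Matrix m n ℝ =>
      Complex.exp (frobInner z.1 z.2 * Complex.I) := by
    have := (measurable_fst (α := Matrix m n ℝ) (β := Matrix m n ℝ)).frobInner measurable_snd
    fun_prop
  have hG : Measurable fun z : Matrix m n ℝ =>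
      ((Real.exp (-(s ^ 2 * frobInner z z / 2)) : ℝ) : ℂ) := by
    have := (measurable_id (α := Matrix m n ℝ)).frobInner measurable_id
    simp only [id] at this
    fun_prop
  rw [← integral_complex_ofReal]
  exact integral_comp_of_indepFun hB hAm hind hF (C := 1)
    (fun z => (Complex.norm_exp_ofReal_mul_I _).le) hG hA.integral_exp_frobInner

end Gaussian

/-- Dropping `-ab` from the numerator leaves `a / N + b / T`, and `√m ≤ m ≤ N, T` for `m = min N T ≥
1`. -/
lemma sub_mul_sub_div_le {N T a b : ℕ} (ha : a ≤ N) (hb : b ≤ T) :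
    ((N : ℝ) * T - ((N : ℝ) - a) * ((T : ℝ) - b)) / ((N : ℝ) * T)
      ≤ ((a : ℝ) + b) / Real.sqrt ((min N T : ℕ) : ℝ) := by
  -- If a dimension is zero, both sides are divisions by zero, hence `0`.
  rcases Nat.eq_zero_or_pos N with rfl | hN
  · simp
  rcases Nat.eq_zero_or_pos T with rfl | hT
  · simp
  have hN' : (0 : ℝ) < N := by exact_mod_cast hN
  have hT' : (0 : ℝ) < T := by exact_mod_cast hT
  have hm : (1 : ℝ) ≤ (min N T : ℕ) := by exact_mod_cast le_min hN hT
  have hs : Real.sqrt ((min N T : ℕ) : ℝ) ≤ (min N T : ℕ) := by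
    rw [Real.sqrt_le_left (by positivity)]
    nlinarith
  have hs0 : 0 < Real.sqrt ((min N T : ℕ) : ℝ) := Real.sqrt_pos.2 (by linarith)
  have hsN : Real.sqrt ((min N T : ℕ) : ℝ) ≤ N := hs.trans (by exact_mod_cast min_le_left N T)
  have hsT : Real.sqrt ((min N T : ℕ) : ℝ) ≤ T := hs.trans (by exact_mod_cast min_le_right N T)
  calc ((N : ℝ) * T - ((N : ℝ) - a) * ((T : ℝ) - b)) / ((N : ℝ) * T)
      ≤ ((a : ℝ) * T + b * N) / (N * T) := by
        gcongr
        nlinarith [mul_nonneg (Nat.cast_nonneg (α := ℝ) a) (Nat.cast_nonneg (α := ℝ) b)]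
    _ = (a : ℝ) / N + b / T := by field_simp
    _ ≤ (a : ℝ) / Real.sqrt ((min N T : ℕ) : ℝ) + b / Real.sqrt ((min N T : ℕ) : ℝ) := by
        gcongr
    _ = _ := by ring

/-! ### Laws of large numbers before projection -/

section LawOfLargeNumbers

variable {Ω : ℕ → Type*} [∀ N, MeasurableSpace (Ω N)] {μ : ∀ N, Measure (Ω N)}
  [∀ N, IsProbabilityMeasure (μ N)] {T : ℕ → ℕ}

lemma tendsto_size (hT : Tendsto T atTop atTop) :
    Tendsto (fun N : ℕ => (N : ℝ) * (T N : ℝ)) atTop atTop :=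
  tendsto_natCast_atTop_atTop.atTop_mul_atTop₀ (tendsto_natCast_atTop_atTop.comp hT)

/-- The Chebyshev rate: the relevant second moments grow like `NT`, against a normalization by
`(NT)²`. -/
lemma tendsto_const_mul_size_div_sq (hT : Tendsto T atTop atTop) (c : ℝ) :
    Tendsto (fun N : ℕ => (N : ℝ) * (T N : ℝ) * c / ((N : ℝ) * (T N : ℝ)) ^ 2) atTop (𝓝 0) := by
  refine ((tendsto_size hT).const_div_atTop c).congr' ?_
  filter_upwards [(tendsto_size hT).eventually_gt_atTop 0] with N hN
  field_simp

lemma tendstoInProb_frobInner_self (hT : Tendsto T atTop atTop)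
    {A : ∀ N, Ω N → Matrix (Fin N) (Fin (T N)) ℝ} {s : ℝ}
    (hA : ∀ N, IIDGaussianEntries (μ N) (A N) s) :
    TendstoInProb μ (fun N ω => frobInner (A N ω) (A N ω) / ((N : ℝ) * (T N : ℝ))) (s ^ 2) := by
  refine tendstoInProb_of_integral_sq (fun N => ?_) ?_
  · have h1 := ((hA N).variance_frobInner.1.mul_const ((N : ℝ) * (T N : ℝ))⁻¹).sub
      (memLp_const (s ^ 2))
    exact h1.integrable_sq
  · refine (tendsto_const_mul_size_div_sq hT
      Var[fun x : ℝ => x * x; gaussianReal 0 (Real.toNNReal (s ^ 2))]).congr' ?_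
    filter_upwards [(tendsto_size hT).eventually_gt_atTop 0] with N hN
    have h2 := (hA N).variance_frobInner
    have h3 := h2.2
    rw [variance_eq_integral h2.1.aestronglyMeasurable.aemeasurable,
      (hA N).integral_frobInner] at h3
    simp only [Fintype.card_fin] at h3
    rw [← h3, ← integral_div]
    refine integral_congr_ae (ae_of_all _ fun ω => ?_)
    dsimp only
    rw [← div_pow, sub_div, mul_div_cancel_right₀ _ hN.ne']

lemma tendstoInProb_frobInner_of_indepFun (hT : Tendsto T atTop atTop)
    {A B : ∀ N, Ω N → Matrix (Fin N) (Fin (T N)) ℝ} {s r : ℝ}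
    (hA : ∀ N, IIDGaussianEntries (μ N) (A N) s) (hB : ∀ N, IIDGaussianEntries (μ N) (B N) r)
    (hind : ∀ N, IndepFun (A N) (B N) (μ N)) :
    TendstoInProb μ (fun N ω => frobInner (A N ω) (B N ω) / ((N : ℝ) * (T N : ℝ))) 0 := by
  have h (N : ℕ) := (hA N).integral_frobInner_sq (hB N) (hind N)
  refine tendstoInProb_of_integral_sq (fun N => ?_) ?_
  · simp only [sub_zero, div_pow]
    exact (h N).1.div_const _
  · simp only [sub_zero, div_pow, integral_div, (h _).2, Fintype.card_fin]
    exact tendsto_const_mul_size_div_sq hT _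

end LawOfLargeNumbers

/-! ### Negligibility of the projections -/

namespace PanelModel

variable {K : ℕ} {Ω : ℕ → Type*} [∀ N, MeasurableSpace (Ω N)] (S : PanelModel K Ω)

lemma measurable_PiAll (N : ℕ) (k : Fin (K + 1)) (i : Fin N) (t : Fin (S.T N)) :
    Measurable fun ω => S.PiAll N ω k i t := by
  have h1 := S.measurable_loading N
  have h2 := S.measurable_factor N
  have hX (k : Fin K) : Measurable fun ω => S.PiX N k ω i t := by
    simp only [PiX, Matrix.of_apply]
    fun_prop
  refine Fin.cases ?_ (fun k => ?_) k
  · simp only [PiAll, Fin.cons_zero, Pi0, Matrix.add_apply, Matrix.sum_apply, Matrix.smul_apply,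
      Gam, Matrix.of_apply, smul_eq_mul]
    fun_prop
  · simpa only [PiAll, Fin.cons_succ] using hX k

lemma measurable_PiU (N : ℕ) : Measurable (S.PiU N) :=
  measurable_matrix_iff.2 fun i p => S.measurable_PiAll N p.1 i p.2

lemma measurable_PiV (N : ℕ) : Measurable (S.PiV N) :=
  measurable_matrix_iff.2 fun t p => S.measurable_PiAll N p.1 p.2 t

lemma measurable_Mu (N : ℕ) : Measurable (S.Mu N) :=
  measurable_orthProj.comp (S.measurable_PiU N)

lemma measurable_Mv (N : ℕ) : Measurable (S.Mv N) :=
  measurable_orthProj.comp (S.measurable_PiV N)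

lemma frobInner_sub_projected (N : ℕ) (ω : Ω N) (A B : Matrix (Fin N) (Fin (S.T N)) ℝ) :
    frobInner (A - S.Mu N ω * A * S.Mv N ω) (B - S.Mu N ω * B * S.Mv N ω)
      = frobInner A B - frobInner (S.Mu N ω * A * S.Mv N ω) (S.Mu N ω * B * S.Mv N ω) :=
  frobInner_sub_conj (orthProj_transpose _) (orthProj_mul_self _) (orthProj_transpose _)
    (orthProj_mul_self _) A B

lemma frobInner_projected (N : ℕ) (ω : Ω N) (A B : Matrix (Fin N) (Fin (S.T N)) ℝ) :
    frobInner (S.Mu N ω * A * S.Mv N ω) (S.Mu N ω * B * S.Mv N ω)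
      = frobInner (S.Mu N ω * A * S.Mv N ω) B :=
  frobInner_conj_conj (orthProj_transpose _) (orthProj_mul_self _) (orthProj_transpose _)
    (orthProj_mul_self _) A B

lemma measurable_matrix_E (N : ℕ) : Measurable (S.E N) :=
  measurable_matrix_iff.2 (S.measurable_E N)

lemma measurable_matrix_EX (N : ℕ) (k : Fin K) : Measurable (S.EX N k) :=
  measurable_matrix_iff.2 (S.measurable_EX N k)

lemma measurable_errors (N : ℕ) (m : Fin (K + 1)) : Measurable fun ω => S.errors N ω m := by
  refine Fin.cases ?_ (fun k => ?_) m
  · simpa only [errors, Fin.cons_zero] using S.measurable_matrix_E N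
  · simpa only [errors, Fin.cons_succ] using S.measurable_matrix_EX N k

lemma measurable_tildeE (N : ℕ) : Measurable (S.tildeE N) :=
  ((S.measurable_Mu N).matrix_mul (S.measurable_matrix_E N)).matrix_mul (S.measurable_Mv N)

lemma measurable_tildeEX (N : ℕ) (k : Fin K) : Measurable (S.tildeEX N k) :=
  ((S.measurable_Mu N).matrix_mul (S.measurable_matrix_EX N k)).matrix_mul (S.measurable_Mv N)

variable {S} {μ : ∀ N, Measure (Ω N)}

lemma indepFun_errors_projectors
    (hindepPi : ∀ N, IndepFun (S.errors N) (fun ω => (S.PiU N ω, S.PiV N ω)) (μ N))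
    (N : ℕ) (m : Fin (K + 1)) :
    IndepFun (fun ω => S.errors N ω m) (fun ω => (S.Mu N ω, S.Mv N ω)) (μ N) := by
  have hg : Measurable fun z : Matrix (Fin N) (Fin (K + 1) × Fin (S.T N)) ℝ ×
      Matrix (Fin (S.T N)) (Fin (K + 1) × Fin N) ℝ => (orthProj z.1, orthProj z.2) :=
    (measurable_orthProj.comp measurable_fst).prodMk (measurable_orthProj.comp measurable_snd)
  exact (hindepPi N).comp (measurable_pi_apply m) hg

variable [∀ N, IsProbabilityMeasure (μ N)]

/-- Joint independence from all that determines the projected regressor errors; this is what allows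
conditioning on them in the law of the score. -/
lemma indepFun_E
    (hindep : ∀ N, iIndepFun (fun (m : Fin (K + 1)) ω => S.errors N ω m) (μ N))
    (hindepPi : ∀ N, IndepFun (S.errors N) (fun ω => (S.PiU N ω, S.PiV N ω)) (μ N)) (N : ℕ) :
    IndepFun (S.E N) (fun ω => ((fun k => S.EX N k ω), (S.PiU N ω, S.PiV N ω))) (μ N) := by
  have hEX : Measurable fun ω => fun k => S.EX N k ω :=
    measurable_pi_lambda _ (S.measurable_matrix_EX N)
  refine indepFun_prodMk_right (S.measurable_matrix_E N) hEX
    ((S.measurable_PiU N).prodMk (S.measurable_PiV N)) ?_ ?_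
  · have h := (hindep N).indepFun_finset {0} (Finset.univ.erase 0) (by simp)
      (S.measurable_errors N)
    have hf : Measurable fun e : ({0} : Finset (Fin (K + 1))) → Matrix (Fin N) (Fin (S.T N)) ℝ =>
        e ⟨0, by simp⟩ := measurable_pi_apply _
    have hg : Measurable fun (e : (Finset.univ.erase (0 : Fin (K + 1)) : Finset _) →
        Matrix (Fin N) (Fin (S.T N)) ℝ) (k : Fin K) => e ⟨k.succ, by simp⟩ :=
      measurable_pi_lambda _ fun k => measurable_pi_apply _
    exact h.comp hf hg
  · have hf : Measurable fun e : Fin (K + 1) → Matrix (Fin N) (Fin (S.T N)) ℝ =>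
        (e 0, fun k : Fin K => e k.succ) :=
      (measurable_pi_apply _).prodMk (measurable_pi_lambda _ fun k => measurable_pi_apply _)
    exact (hindepPi N).comp hf measurable_id

/-- Projecting a Gaussian matrix changes its squared norm by `o_P(NT)`. -/
lemma tendstoInProb_defect
    (hrank : IsLittleOP μ (fun N ω => (S.ru N ω : ℝ) + (S.rv N ω : ℝ))
      (fun N => Real.sqrt ((min N (S.T N) : ℕ) : ℝ)))
    {A : ∀ N, Ω N → Matrix (Fin N) (Fin (S.T N)) ℝ} {s : ℝ}
    (hA : ∀ N, IIDGaussianEntries (μ N) (A N) s)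
    (hind : ∀ N, IndepFun (A N) (fun ω => (S.Mu N ω, S.Mv N ω)) (μ N)) :
    TendstoInProb μ (fun N ω => (frobInner (A N ω) (A N ω)
      - frobInner (S.Mu N ω * A N ω * S.Mv N ω) (S.Mu N ω * A N ω * S.Mv N ω))
        / ((N : ℝ) * (S.T N : ℝ))) 0 := by
  set W : ∀ N, Ω N → ℝ := fun N ω =>
    ((N : ℝ) * (S.T N : ℝ) - (S.Mu N ω).trace * (S.Mv N ω).trace) / ((N : ℝ) * (S.T N : ℝ))
    with hW
  have htu (N ω) : (S.Mu N ω).trace = (N : ℝ) - S.ru N ω := by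
    simp [Mu, ru, trace_orthProj]
  have htv (N ω) : (S.Mv N ω).trace = (S.T N : ℝ) - S.rv N ω := by
    simp [Mv, rv, trace_orthProj]
  have hru (N ω) : S.ru N ω ≤ N := by
    simpa [ru] using (S.PiU N ω).rank_le_card_height
  have hrv (N ω) : S.rv N ω ≤ S.T N := by
    simpa [rv] using (S.PiV N ω).rank_le_card_height
  have hru' (N : ℕ) (ω : Ω N) : (0 : ℝ) ≤ (N : ℝ) - S.ru N ω := sub_nonneg.2 (by exact_mod_cast hru N ω)
  have hrv' (N : ℕ) (ω : Ω N) : (0 : ℝ) ≤ (S.T N : ℝ) - S.rv N ω := sub_nonneg.2 (by exact_mod_cast hrv N ω)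
  have htr0 (N ω) : 0 ≤ (S.Mu N ω).trace * (S.Mv N ω).trace := by
    rw [htu, htv]
    exact mul_nonneg (hru' N ω) (hrv' N ω)
  have htr1 (N ω) : (S.Mu N ω).trace * (S.Mv N ω).trace ≤ (N : ℝ) * (S.T N : ℝ) := by
    rw [htu, htv]
    exact mul_le_mul (by linarith [Nat.cast_nonneg (α := ℝ) (S.ru N ω)])
      (by linarith [Nat.cast_nonneg (α := ℝ) (S.rv N ω)]) (hrv' N ω) (Nat.cast_nonneg _)
  have htrm (N) : Measurable fun ω => (S.Mu N ω).trace * (S.Mv N ω).trace := by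
    have h1 (i) := (S.measurable_Mu N).matrix_entry i i
    have h2 (i) := (S.measurable_Mv N).matrix_entry i i
    simp only [Matrix.trace, Matrix.diag]
    fun_prop
  have hW0 (N ω) : 0 ≤ W N ω :=
    div_nonneg (sub_nonneg.2 (htr1 N ω)) (by positivity)
  have hW1 (N ω) : W N ω ≤ 1 :=
    div_le_one_of_le₀ (by linarith [htr0 N ω]) (by positivity)
  have hWP : TendstoInProb μ W 0 := by
    have h0 : TendstoInProb μ (fun N (_ : Ω N) => (0 : ℝ)) 0 := by
      intro ε hε
      simp [hε.not_ge]
    -- `hrank` is itself convergence to `0` of the ratio that dominates `W`.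
    refine h0.mono hrank fun N ω => ?_
    rw [sub_zero, abs_of_nonneg (hW0 N ω), hW]
    simp only [htu, htv]
    exact sub_mul_sub_div_le (hru N ω) (hrv N ω)
  have hWm (N) : Measurable (W N) := by
    have := htrm N
    fun_prop
  have hWI := (hWP.tendsto_integral hWm hW0 hW1).const_mul (s ^ 2)
  rw [mul_zero] at hWI
  have hc (N) := (hA N).integral_conj (S.measurable_Mu N) (S.measurable_Mv N)
    (fun ω => abs_orthProj_le _) (fun ω => abs_orthProj_le _) (hind N)
  refine tendstoInProb_zero_of_integral (fun N ω => ?_) (fun N => ?_) ?_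
  · rw [← frobInner_sub_projected]
    exact div_nonneg (frobInner_self_nonneg _) (by positivity)
  · simp only [frobInner_projected]
    exact ((hA N).integrable_frobInner.sub (hc N).1).div_const _
  -- The mean defect over `NT` is exactly `s ^ 2` times the mean of `W`.
  · refine hWI.congr fun N => ?_
    simp only [frobInner_projected, hW]
    have htri : Integrable (fun ω => (S.Mu N ω).trace * (S.Mv N ω).trace) (μ N) :=
      Integrable.of_bound (htrm N).aestronglyMeasurable ((N : ℝ) * (S.T N : ℝ))
        (ae_of_all _ fun ω => by rw [Real.norm_of_nonneg (htr0 N ω)]; exact htr1 N ω)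
    rw [integral_div, integral_div, integral_sub (integrable_const _) htri,
      integral_sub (hA N).integrable_frobInner (hc N).1, (hc N).2, (hA N).integral_frobInner]
    simp
    ring

/-- The mixed defect is dominated by the sum of the two diagonal defects, so no independence between
`A` and `B` is needed. -/
lemma tendstoInProb_frobInner_conj
    (hrank : IsLittleOP μ (fun N ω => (S.ru N ω : ℝ) + (S.rv N ω : ℝ))
      (fun N => Real.sqrt ((min N (S.T N) : ℕ) : ℝ)))
    {A B : ∀ N, Ω N → Matrix (Fin N) (Fin (S.T N)) ℝ} {s r c : ℝ}
    (hA : ∀ N, IIDGaussianEntries (μ N) (A N) s) (hB : ∀ N, IIDGaussianEntries (μ N) (B N) r)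
    (hindA : ∀ N, IndepFun (A N) (fun ω => (S.Mu N ω, S.Mv N ω)) (μ N))
    (hindB : ∀ N, IndepFun (B N) (fun ω => (S.Mu N ω, S.Mv N ω)) (μ N))
    (h : TendstoInProb μ
      (fun N ω => frobInner (A N ω) (B N ω) / ((N : ℝ) * (S.T N : ℝ))) c) :
    TendstoInProb μ (fun N ω => frobInner (S.Mu N ω * A N ω * S.Mv N ω)
      (S.Mu N ω * B N ω * S.Mv N ω) / ((N : ℝ) * (S.T N : ℝ))) c := by
  have hZ := ((tendstoInProb_defect hrank hA hindA).add
    (tendstoInProb_defect hrank hB hindB))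
  rw [add_zero] at hZ
  refine h.mono hZ fun N ω => ?_
  have h1 := two_mul_abs_frobInner_le (A N ω - S.Mu N ω * A N ω * S.Mv N ω)
    (B N ω - S.Mu N ω * B N ω * S.Mv N ω)
  rw [frobInner_sub_projected, frobInner_sub_projected, frobInner_sub_projected] at h1
  rw [← sub_div, ← add_div, abs_div, abs_of_nonneg (a := (N : ℝ) * (S.T N : ℝ)) (by positivity),
    abs_sub_comm]
  gcongr
  linarith [abs_nonneg (frobInner (A N ω) (B N ω) -
    frobInner (S.Mu N ω * A N ω * S.Mv N ω) (S.Mu N ω * B N ω * S.Mv N ω))]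

end PanelModel

/-! ### Conditional Gaussianity and limit law of the score -/

namespace PanelModel

variable {K : ℕ} {Ω : ℕ → Type*} [∀ N, MeasurableSpace (Ω N)] {S : PanelModel K Ω}
  {μ : ∀ N, Measure (Ω N)} [∀ N, IsProbabilityMeasure (μ N)]

/-- The vector of the scalar products `⟨M_u E_k M_v, M_u E M_v⟩ / √(NT)`. -/
noncomputable def score (S : PanelModel K Ω) (N : ℕ) (ω : Ω N) : EuclideanSpace ℝ (Fin K) :=
  WithLp.toLp 2 fun k : Fin K =>
    frobInner (S.tildeEX N k ω) (S.tildeE N ω) / Real.sqrt ((N : ℝ) * (S.T N : ℝ))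

lemma measurable_score (N : ℕ) : Measurable (S.score N) := by
  refine (WithLp.measurable_toLp 2 (Fin K → ℝ)).comp (measurable_pi_lambda _ fun k => ?_)
  exact ((S.measurable_tildeEX N k).frobInner (S.measurable_tildeE N)).div_const _

/-- The quadratic form `∑_{k,l} t_k t_l ⟨M_u E_k M_v, M_u E_l M_v⟩ / (NT)`. -/
noncomputable def gramForm (S : PanelModel K Ω) (t : EuclideanSpace ℝ (Fin K)) (N : ℕ)
    (ω : Ω N) : ℝ :=
  ∑ p : Fin K × Fin K, (t p.1 * t p.2) *
    (frobInner (S.tildeEX N p.1 ω) (S.tildeEX N p.2 ω) / ((N : ℝ) * (S.T N : ℝ)))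

lemma measurable_gramForm (t : EuclideanSpace ℝ (Fin K)) (N : ℕ) :
    Measurable (S.gramForm t N) :=
  Finset.measurable_sum _ fun p _ => Measurable.const_mul
    (((S.measurable_tildeEX N p.1).frobInner (S.measurable_tildeEX N p.2)).div_const _) _

/-- The linear combination of the projected regressor errors with coefficients `t_k / √(NT)`. -/
noncomputable def tildeCombination (S : PanelModel K Ω) (t : EuclideanSpace ℝ (Fin K)) (N : ℕ)
    (ω : Ω N) : Matrix (Fin N) (Fin (S.T N)) ℝ :=
  ∑ k, (t k / Real.sqrt ((N : ℝ) * (S.T N : ℝ))) • S.tildeEX N k ω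

lemma frobInner_tildeCombination_left (t : EuclideanSpace ℝ (Fin K)) (N : ℕ) (ω : Ω N)
    (B : Matrix (Fin N) (Fin (S.T N)) ℝ) :
    frobInner (S.tildeCombination t N ω) B
      = ∑ k, t k / Real.sqrt ((N : ℝ) * (S.T N : ℝ)) * frobInner (S.tildeEX N k ω) B := by
  simp [tildeCombination, frobInner, Matrix.transpose_sum, Matrix.sum_mul, Matrix.trace_sum]

lemma frobInner_tildeCombination_self (t : EuclideanSpace ℝ (Fin K)) (N : ℕ) (ω : Ω N) :
    frobInner (S.tildeCombination t N ω) (S.tildeCombination t N ω) = S.gramForm t N ω := by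
  rw [frobInner_tildeCombination_left, gramForm, Fintype.sum_prod_type]
  refine Finset.sum_congr rfl fun k _ => ?_
  rw [frobInner_comm, frobInner_tildeCombination_left, Finset.mul_sum]
  refine Finset.sum_congr rfl fun l _ => ?_
  rw [frobInner_comm]
  have h : Real.sqrt ((N : ℝ) * (S.T N : ℝ)) * Real.sqrt ((N : ℝ) * (S.T N : ℝ))
      = (N : ℝ) * (S.T N : ℝ) := Real.mul_self_sqrt (by positivity)
  generalize Real.sqrt ((N : ℝ) * (S.T N : ℝ)) = c at h ⊢
  rw [← h]
  simp only [div_eq_mul_inv, mul_inv]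
  ring

/-- Projecting one factor is enough, so the score is linear in the raw Gaussian matrix `E`. -/
lemma inner_score (t : EuclideanSpace ℝ (Fin K)) (N : ℕ) (ω : Ω N) :
    inner ℝ (S.score N ω) t = frobInner (S.tildeCombination t N ω) (S.E N ω) := by
  rw [frobInner_tildeCombination_left, PiLp.inner_apply]
  refine Finset.sum_congr rfl fun k _ => ?_
  have h : frobInner (S.tildeEX N k ω) (S.tildeE N ω) = frobInner (S.tildeEX N k ω) (S.E N ω) :=
    S.frobInner_projected N ω (S.EX N k ω) (S.E N ω)
  simp only [score, h, RCLike.inner_apply, conj_trivial]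
  ring

/-- A linear combination of matrices projected on the orthogonals of two column spans. -/
noncomputable def projectedCombination {m n p q : Type*} [Fintype m] [DecidableEq m] [Fintype n]
    [DecidableEq n] (c : Fin K → ℝ) (z : (Fin K → Matrix m n ℝ) × Matrix m p ℝ × Matrix n q ℝ) :
    Matrix m n ℝ :=
  ∑ k, c k • (orthProj z.2.1 * z.1 k * orthProj z.2.2)

lemma measurable_projectedCombination {m n p q : Type*} [Fintype m] [DecidableEq m] [Fintype n]
    [DecidableEq n] [Fintype p] [Fintype q] (c : Fin K → ℝ) :
    Measurable (projectedCombination (m := m) (n := n) (p := p) (q := q) c) := by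
  refine measurable_matrix_iff.2 fun i j => ?_
  simp only [projectedCombination, Matrix.sum_apply, Matrix.smul_apply, smul_eq_mul]
  refine Finset.measurable_sum _ fun k _ => Measurable.const_mul (Measurable.matrix_entry ?_ i j) _
  exact ((measurable_orthProj.comp (measurable_fst.comp measurable_snd)).matrix_mul
    ((measurable_pi_apply k).comp measurable_fst)).matrix_mul
    (measurable_orthProj.comp (measurable_snd.comp measurable_snd))

/-- Exhibits the combination as a measurable function of variables independent of `E`. -/
lemma tildeCombination_eq (t : EuclideanSpace ℝ (Fin K)) (N : ℕ) :
    S.tildeCombination t N = fun ω =>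
      projectedCombination (fun k => t k / Real.sqrt ((N : ℝ) * (S.T N : ℝ)))
        ((fun k => S.EX N k ω), (S.PiU N ω, S.PiV N ω)) := by
  funext ω
  simp only [tildeCombination, tildeEX, Mu, Mv, projectedCombination]

lemma measurable_tildeCombination (t : EuclideanSpace ℝ (Fin K)) (N : ℕ) :
    Measurable (S.tildeCombination t N) := by
  rw [tildeCombination_eq]
  exact (measurable_projectedCombination _).comp
    ((measurable_pi_lambda _ (S.measurable_matrix_EX N)).prodMk
      ((S.measurable_PiU N).prodMk (S.measurable_PiV N)))

lemma indepFun_tildeCombination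
    (hindep : ∀ N, iIndepFun (fun (m : Fin (K + 1)) ω => S.errors N ω m) (μ N))
    (hindepPi : ∀ N, IndepFun (S.errors N) (fun ω => (S.PiU N ω, S.PiV N ω)) (μ N))
    (t : EuclideanSpace ℝ (Fin K)) (N : ℕ) :
    IndepFun (S.tildeCombination t N) (S.E N) (μ N) := by
  rw [tildeCombination_eq]
  exact (indepFun_E hindep hindepPi N).symm.comp (measurable_projectedCombination _) measurable_id

/-- The characteristic function of the score. -/
lemma charFun_score {σ : ℝ} (hE : ∀ N, IIDGaussianEntries (μ N) (S.E N) σ)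
    (hindep : ∀ N, iIndepFun (fun (m : Fin (K + 1)) ω => S.errors N ω m) (μ N))
    (hindepPi : ∀ N, IndepFun (S.errors N) (fun ω => (S.PiU N ω, S.PiV N ω)) (μ N))
    (t : EuclideanSpace ℝ (Fin K)) (N : ℕ) :
    charFun ((μ N).map (S.score N)) t
      = ((∫ ω, Real.exp (-(σ ^ 2 / 2 * S.gramForm t N ω)) ∂μ N : ℝ) : ℂ) := by
  rw [charFun_apply, integral_map (measurable_score N).aemeasurable (by fun_prop)]
  simp only [inner_score]
  rw [(hE N).integral_exp_frobInner_indep (S.measurable_matrix_E N)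
    (measurable_tildeCombination t N) (indepFun_tildeCombination hindep hindepPi t N)]
  simp only [frobInner_tildeCombination_self]
  congr 2
  ext ω
  congr 2
  ring

lemma tendstoInDistribution_score {σ : ℝ} (hE : ∀ N, IIDGaussianEntries (μ N) (S.E N) σ)
    (hindep : ∀ N, iIndepFun (fun (m : Fin (K + 1)) ω => S.errors N ω m) (μ N))
    (hindepPi : ∀ N, IndepFun (S.errors N) (fun ω => (S.PiU N ω, S.PiV N ω)) (μ N))
    {V : Matrix (Fin K) (Fin K) ℝ} (hV : V.PosSemidef)
    (hgram : ∀ k l : Fin K, TendstoInProb μ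
      (fun N ω => frobInner (S.tildeEX N k ω) (S.tildeEX N l ω) / ((N : ℝ) * (S.T N : ℝ)))
      (V k l)) :
    TendstoInDistribution S.score atTop
      (id : EuclideanSpace ℝ (Fin K) → EuclideanSpace ℝ (Fin K)) μ
      (multivariateGaussian 0 (σ ^ 2 • V)) := by
  refine ⟨fun N => (measurable_score N).aemeasurable, by fun_prop, ?_⟩
  refine ProbabilityMeasure.tendsto_of_tendsto_charFun fun t => ?_
  simp only [ProbabilityMeasure.coe_mk, Measure.map_id]
  rw [charFun_multivariateGaussian (hV.smul (sq_nonneg σ))]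
  simp only [charFun_score hE hindep hindepPi]
  set q : ℝ := ∑ p : Fin K × Fin K, (t p.1 * t p.2) * V p.1 p.2 with hq
  have hqV : t.ofLp ⬝ᵥ (V.mulVec t.ofLp) = q := by
    simp only [hq, dotProduct, Matrix.mulVec, Finset.mul_sum, Fintype.sum_prod_type]
    exact Finset.sum_congr rfl fun k _ => Finset.sum_congr rfl fun l _ => by ring
  have hq0 : 0 ≤ q := by
    have := hV.dotProduct_mulVec_nonneg t.ofLp
    rwa [star_trivial, hqV] at this
  have hP' : TendstoInProb μ (S.gramForm t) q :=
    TendstoInProb.sum Finset.univ fun p _ => (hgram p.1 p.2).const_mul (t p.1 * t p.2)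
  have hP := hP'.const_mul (σ ^ 2 / 2)
  have hm (N) : Measurable fun ω => σ ^ 2 / 2 * S.gramForm t N ω :=
    (measurable_gramForm t N).const_mul _
  -- The Gram form is a squared norm; this sign keeps the exponential bounded.
  have h0 (N) (ω : Ω N) : 0 ≤ σ ^ 2 / 2 * S.gramForm t N ω := by
    rw [← frobInner_tildeCombination_self]
    exact mul_nonneg (by positivity) (frobInner_self_nonneg _)
  have hlim := hP.tendsto_integral_exp_neg hm h0 (mul_nonneg (by positivity) hq0)
  have hlim' := (Complex.continuous_ofReal.tendsto _).comp hlim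
  have he : Complex.exp ((inner ℝ t (0 : EuclideanSpace ℝ (Fin K)) : ℝ) * Complex.I
      - ((t.ofLp ⬝ᵥ ((σ ^ 2 • V).mulVec t.ofLp) : ℝ) : ℂ) / 2)
      = ((Real.exp (-(σ ^ 2 / 2 * q)) : ℝ) : ℂ) := by
    rw [Matrix.smul_mulVec, dotProduct_smul, hqV, inner_zero_right]
    push_cast
    congr 1
    simp only [smul_eq_mul]
    push_cast
    ring
  rw [he]
  exact hlim'

end PanelModel

end PanelFactor

theorem corollary1 {K : ℕ} {Ω : ℕ → Type*} [∀ N, MeasurableSpace (Ω N)]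
    (μ : ∀ N, Measure (Ω N)) [∀ N, IsProbabilityMeasure (μ N)]
    (S : PanelFactor.PanelModel K Ω)
    (σ : ℝ) (hσ : 0 < σ) (σX : Fin K → ℝ) (hσX : ∀ k, 0 < σX k)
    (hE : ∀ N, PanelFactor.IIDGaussianEntries (μ N) (S.E N) σ)
    (hEX : ∀ N k, PanelFactor.IIDGaussianEntries (μ N) (S.EX N k) (σX k))
    (hindep : ∀ N, iIndepFun (fun (m : Fin (K + 1)) ω => S.errors N ω m) (μ N))
    (hindepPi : ∀ N, IndepFun (S.errors N) (fun ω => (S.PiU N ω, S.PiV N ω)) (μ N))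
    (hrank : PanelFactor.IsLittleOP μ (fun N ω => (S.ru N ω : ℝ) + (S.rv N ω : ℝ))
      (fun N => Real.sqrt ((min N (S.T N) : ℕ) : ℝ))) :
    S.ErrorAsymptotics μ := by
  have hindE (N : ℕ) : IndepFun (S.E N) (fun ω => (S.Mu N ω, S.Mv N ω)) (μ N) :=
    PanelFactor.PanelModel.indepFun_errors_projectors hindepPi N 0
  have hindEX (k : Fin K) (N : ℕ) :
      IndepFun (S.EX N k) (fun ω => (S.Mu N ω, S.Mv N ω)) (μ N) :=
    PanelFactor.PanelModel.indepFun_errors_projectors hindepPi N k.succ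
  have hV : (Matrix.diagonal fun k => σX k ^ 2).PosDef :=
    Matrix.PosDef.diagonal fun k => pow_pos (hσX k) 2
  have hgram (k l : Fin K) : PanelFactor.TendstoInProb μ
      (fun N ω => PanelFactor.frobInner (S.tildeEX N k ω) (S.tildeEX N l ω)
        / ((N : ℝ) * (S.T N : ℝ))) (Matrix.diagonal (fun k => σX k ^ 2) k l) := by
    refine PanelFactor.PanelModel.tendstoInProb_frobInner_conj hrank (fun N => hEX N k)
      (fun N => hEX N l) (hindEX k) (hindEX l) ?_
    rcases eq_or_ne k l with rfl | hkl
    · rw [Matrix.diagonal_apply_eq]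
      exact PanelFactor.tendstoInProb_frobInner_self S.tendsto_T fun N => hEX N k
    · rw [Matrix.diagonal_apply_ne _ hkl]
      exact PanelFactor.tendstoInProb_frobInner_of_indepFun S.tendsto_T (fun N => hEX N k)
        (fun N => hEX N l)
        fun N => (hindep N).indepFun ((Fin.succ_injective K).ne hkl)
  -- The limits are those without projection: `Σ = diag(σX k ^ 2)` and `s = σ`.
  refine ⟨_, hV, hgram, σ, hσ, ?_, ?_⟩
  · simp only [PanelFactor.frobNorm_sq]
    exact PanelFactor.PanelModel.tendstoInProb_frobInner_conj hrank hE hE hindE hindE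
      (PanelFactor.tendstoInProb_frobInner_self S.tendsto_T hE)
  · exact PanelFactor.PanelModel.tendstoInDistribution_score hE hindep hindepPi
      hV.posSemidef hgram
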